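/- Let $d\ge 0$, let $\Lambda$ be a locally finite Borel measure on $\mathbb{R}^d$, and let $h:\mathbb{R}^d\times\mathbb{R}^d\to[0,1]$ be measurable with $$\sup_{x\in\mathbb{R}^d}\int_{\mathbb{R}^d}h(x,y)\,\Lambda(dy)<\infty .$$ Let $(\Phi,C)$ be a Poisson rain with random conflict relation, with ground intensity $\Lambda$ and expected conflict function $h$. That is: $\Phi$ is a Poisson point process on $\mathbb{R}^d\times[0,\infty)$ of intensity measure $\Lambda\otimes\mathrm{Lebesgue}$, whose points are pairs $x$ = (location, timer $t(x)$); and $C$ is a family of $\{0,1\}$-valued random variables $C(x,y)$ indexed by the pairs of points of $\Phi$ such that almost surely $C(x,x)=0$ and $C(x,y)=C(y,x)$ for all $x,y\in\Phi$, and such that, given $\Phi$, the variables $C(x,y)$ indexed by the unordered pairs of distinct points of $\Phi$ are independent, with $C(x,y)=1$ with conditional probability $h$ evaluated at the locations of $x$ and $y$. The conflict graph is the directed graph on $\Phi$ with an edge from $y$ to $x$ when $C(x,y)=1$ and $t(y)<t(x)$; write $\mathcal E$ for its set of edges. The set $\mathcal{A}(x)$ of ancestors of $x\in\Phi$ consists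 of all $y\in\Phi$ from which a non-empty directed path leads to $x$. The $k$-Matérn sets are $\Phi_0=\Phi$ and $\Phi_{k+1}=\{x\in\Phi:\ \text{for all }y\in\Phi_k,\ C(x,y)=1\Rightarrow t(x)<t(y)\}$. Then, almost surely: 1. the conflict graph has the finite history property: $\mathcal{A}(x)$ is finite for every $x\in\Phi$; 2. consequently the $\infty$-Matérn process is well defined: there is exactly one function $e_\infty:\Phi\to\{0,1\}$ such that $e_\infty(x)=1$ if $\mathcal{A}(x)=\emptyset$ and $e_\infty(x)=\prod_{y\in\Phi,\,(y,x)\in\mathcal{E}}(1-e_\infty(y))$ otherwise; put $\Phi_\infty=\{x\in\Phi:\ e_\infty(x)=1\}$; 3. the $\infty$-Matérn process is the limit of the $k$-Matérn processes: $\lim_{k\to\infty}\mathbf 1_{\{x\in\Phi_k\}}=e_\infty(x)$ for every $x\in\Phi$, and $\bigcup_{k\ge0}\Phi_{2k+1}=\Phi_\infty=\bigcap_{k\ge0}\Phi_{2k}$. -/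

import Mathlib

open MeasureTheory ProbabilityTheory Filter Topology
open scoped NNReal ENNReal

namespace MaternRain

/-- A point is a pair (location, timer) in `ℝᵈ × ℝ⁺`. -/
abbrev Point (d : ℕ) : Type := EuclideanSpace ℝ (Fin d) × ℝ≥0

section Deterministic

variable {d : ℕ}

/-- `(x, y)` is an edge of the conflict graph of the configuration `φ` with conflict relation `c`:
`x` and `y` are in conflict and `x` arrives before `y`. -/
def IsEdge (φ : Set (Point d)) (c : Point d → Point d → Prop) (x y : Point d) : Prop :=
  x ∈ φ ∧ y ∈ φ ∧ c x y ∧ x.2 < y.2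

/-- The ancestors of `x`: the points from which a nonempty directed path leads to `x`. -/
def ancestors (φ : Set (Point d)) (c : Point d → Point d → Prop) (x : Point d) : Set (Point d) :=
  {y | y ∈ φ ∧ Relation.TransGen (IsEdge φ c) y x}

/-- The finite history property of the conflict graph. -/
def FiniteHistory (φ : Set (Point d)) (c : Point d → Point d → Prop) : Prop :=
  ∀ x ∈ φ, (ancestors φ c x).Finite

/-- The result of the `k`-Matérn construction. -/
def matern (φ : Set (Point d)) (c : Point d → Point d → Prop) : ℕ → Set (Point d)
  | 0 => φ
  | k + 1 => {x | x ∈ φ ∧ ∀ y ∈ matern φ c k, c x y → x.2 < y.2}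

/-- The recursion that defines the indicator of the `∞`-Matérn set (used only when the conflict
graph has the finite history property, so that the products are finite). -/
structure IsInftyIndicator (φ : Set (Point d)) (c : Point d → Point d → Prop) (e : φ → ℤ) :
    Prop where
  zero_or_one : ∀ x, e x = 0 ∨ e x = 1
  of_no_ancestor : ∀ x : φ, ancestors φ c x = ∅ → e x = 1
  of_ancestor : ∀ x : φ, ancestors φ c x ≠ ∅ →
    e x = ∏ᶠ (y : φ) (_ : IsEdge φ c y x), (1 - e y)

/-- The result of the `∞`-Matérn construction: the points where the indicator is one. -/
def maternInfty (φ : Set (Point d)) (c : Point d → Point d → Prop) : Set (Point d) :=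
  {x | ∃ e : φ → ℤ, IsInftyIndicator φ c e ∧ ∃ hx : x ∈ φ, e ⟨x, hx⟩ = 1}

end Deterministic

/-- Lebesgue measure on `ℝ⁺ = [0, ∞)`. -/
noncomputable def timeMeasure : Measure ℝ≥0 :=
  Measure.comap ((↑) : ℝ≥0 → ℝ) volume

section Processes

variable {Ω : Type*} [MeasurableSpace Ω]

/-- The random set `Φ` is a Poisson point process of intensity measure `μ`: the numbers of points
in disjoint sets are independent, and Poisson distributed with mean given by `μ`. -/
structure IsPoissonProcess {α : Type*} [MeasurableSpace α] (P : Measure Ω) (μ : Measure α)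
    (Φ : Ω → Set α) : Prop where
  hasLaw_count : ∀ B : Set α, MeasurableSet B → μ B < ∞ →
    HasLaw (fun ω => (Φ ω ∩ B).encard)
      ((poissonMeasure (μ B).toNNReal).map (Nat.cast : ℕ → ℕ∞)) P
  indep_count : ∀ (n : ℕ) (B : Fin n → Set α), (∀ i, MeasurableSet (B i)) →
    Pairwise (fun i j => Disjoint (B i) (B j)) →
    iIndepFun (fun i ω => (Φ ω ∩ B i).encard) P

/-- `(κ, X)` is a measurable listing without repetition of the random set `Φ`: almost surely
`X 0, X 1, …` (the `X n` with `n < κ`) are exactly the points of `Φ`, each listed once. -/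
structure IsListing {α : Type*} [MeasurableSpace α] (P : Measure Ω) (Φ : Ω → Set α)
    (κ : Ω → ℕ∞) (X : ℕ → Ω → α) : Prop where
  measurable_card : Measurable κ
  measurable_point : ∀ n, Measurable (X n)
  bijOn : ∀ᵐ ω ∂P, Set.BijOn (fun n => X n ω) {n : ℕ | (n : ℕ∞) < κ ω} (Φ ω)

/-- The σ-algebra generated by a listing: the information contained in the realization of the
listed points. -/
abbrev listingSigma {α : Type*} [MeasurableSpace α] (κ : Ω → ℕ∞) (X : ℕ → Ω → α) :
    MeasurableSpace Ω :=
  MeasurableSpace.comap κ inferInstance ⊔ ⨆ n, MeasurableSpace.comap (X n) inferInstance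

/-- The event that the `i`-th and `j`-th listed points exist. -/
def pairExists (κ : Ω → ℕ∞) (i j : ℕ) : Set Ω :=
  {ω | (i : ℕ∞) < κ ω ∧ (j : ℕ∞) < κ ω}

/-- The event that the `i`-th and `j`-th listed points exist and are in conflict. -/
def conflictEvent {α : Type*} (C : Ω → α → α → Prop) (κ : Ω → ℕ∞) (X : ℕ → Ω → α) (i j : ℕ) :
    Set Ω :=
  {ω | ω ∈ pairExists κ i j ∧ C ω (X i ω) (X j ω)}

/-- `C` is, given the realization of `Φ`, a family of independent Bernoulli random variables indexed
by the unordered pairs of distinct points of `Φ`, with success probability `p x y` for the pair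
`{x, y}`.  To speak of these variables and of conditioning on `Φ`, the points are listed
measurably. -/
def IsConditionallyBernoulli {α : Type*} [MeasurableSpace α] (P : Measure Ω) (p : α → α → ℝ)
    (Φ : Ω → Set α) (C : Ω → α → α → Prop) : Prop :=
  ∃ (κ : Ω → ℕ∞) (X : ℕ → Ω → α), IsListing P Φ κ X ∧
    (∀ i j, i ≠ j → MeasurableSet (conflictEvent C κ X i j)) ∧
    (∀ S : Finset {q : ℕ × ℕ // q.1 < q.2},
      P⟦⋂ q ∈ S, conflictEvent C κ X q.1.1 q.1.2 | listingSigma κ X⟧ =ᵐ[P]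
        ∏ q ∈ S, P⟦conflictEvent C κ X q.1.1 q.1.2 | listingSigma κ X⟧) ∧
    (∀ i j, i ≠ j → P⟦conflictEvent C κ X i j | listingSigma κ X⟧ =ᵐ[P]
      (pairExists κ i j).indicator (fun ω => p (X i ω) (X j ω)))

/-- `(Φ, C)` is a Poisson rain with random conflict relation, of ground intensity `Λ` and expected
conflict function `h`. -/
structure IsPRRCR {d : ℕ} (P : Measure Ω) (Λ : Measure (EuclideanSpace ℝ (Fin d)))
    (h : EuclideanSpace ℝ (Fin d) → EuclideanSpace ℝ (Fin d) → ℝ)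
    (Φ : Ω → Set (Point d)) (C : Ω → Point d → Point d → Prop) : Prop where
  poisson : IsPoissonProcess P (Λ.prod timeMeasure) Φ
  irrefl : ∀ᵐ ω ∂P, ∀ x ∈ Φ ω, ¬ C ω x x
  symm : ∀ᵐ ω ∂P, ∀ x ∈ Φ ω, ∀ y ∈ Φ ω, C ω x y → C ω y x
  bernoulli : IsConditionallyBernoulli P (fun x y => h x.1 y.1) Φ C

end Processes

end MaternRain

/-!
The heart of the matter is the finite history property; given it, the rest is deterministic.

*Finite history.* An ancestor of `x` is the end of a chain of points `x = z₀, z₁, …, zₙ` of `Φ` with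
decreasing timers in which consecutive points are in conflict. Fix a set `A` of bounded timers and
finite intensity; it suffices that the expected number of chains, of all lengths, that start in `A`
is finite (`IsPRRCR.ae_finiteHistory`). Given the points, the conflicts along a chain are
independent, because a chain uses no unordered pair twice (`condExp_pathConflict`). This turns the
expected number of chains of `n` steps into the integral of a product of conflict probabilities
against the intensity measure of the `(n + 1)`-tuples of points. On tuples with distinct timers that
measure is the product of the intensity measure `Λ ⊗ Lebesgue`: such tuples are covered by products
of disjoint sets, where the claim is just the independence of the counts and the formula for their
means (`IsPoissonProcess.tupleMeasure_restrict_injective`). The integral is bounded step by step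
(`lintegral_chainWeight_le`): if `M` bounds `∫ h(x, y) Λ(dy)`, then the integral of `h(x, y)
exp(a s)` over all `(y, s)` with `s < t` is at most `(M / a) exp(a t)`, so that with `a = 2 M + 1`
the chains of `n` steps contribute at most a constant times `2⁻ⁿ`.

*No ties.* Almost surely the timers are distinct (`IsPoissonProcess.ae_timer_injOn`): two points
with equal timers lie over a common interval of length `1 / m`, an event of probability `O(1 / m²)`
for each of the `O(m)` intervals. Hence two points in conflict are always comparable, and a point is
kept in step `k + 1` of the Matérn construction iff none of its parents was kept in step `k`.

*The deterministic part.* With finite history the parent relation is well founded, so that the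
recursion for the `∞`-Matérn indicator has exactly one solution. By well-founded induction the
`k`-Matérn sets stabilize at it at each point (`FiniteHistory.eventually_mem_matern_iff`), and by
induction on `k` it lies between the sets of odd and of even index
(`IsConflictRelation.matern_sandwich`).
-/

namespace MaternRain

/-! ### The deterministic construction on a graph with finite history -/

section Graph

variable {d : ℕ} {φ : Set (Point d)} {c : Point d → Point d → Prop}

/-- `c` is a *genuine conflict relation* on `φ`: symmetric, and never relating two points of `φ`
with equal timers (in particular irreflexive on `φ`). -/
structure IsConflictRelation (φ : Set (Point d)) (c : Point d → Point d → Prop) : Prop where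
  symm : ∀ x ∈ φ, ∀ y ∈ φ, c x y → c y x
  timer_ne : ∀ x ∈ φ, ∀ y ∈ φ, c x y → x.2 ≠ y.2

lemma IsEdge.mem_ancestors {x y : Point d} (h : IsEdge φ c y x) : y ∈ ancestors φ c x :=
  ⟨h.1, .single h⟩

lemma timer_lt_of_transGen {x y : Point d} (h : Relation.TransGen (IsEdge φ c) y x) :
    y.2 < x.2 := by
  induction h with
  | single h => exact h.2.2.2
  | tail _ h ih => exact ih.trans h.2.2.2

lemma IsEdge.ancestors_ssubset {x y : Point d} (h : IsEdge φ c y x) :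
    ancestors φ c y ⊂ ancestors φ c x := by
  have hsub : ancestors φ c y ⊆ ancestors φ c x := fun z hz => ⟨hz.1, hz.2.tail h⟩
  exact (Set.ssubset_iff_of_subset hsub).2
    ⟨y, h.mem_ancestors, fun hy => (timer_lt_of_transGen hy.2).false⟩

lemma FiniteHistory.finite_edges (hfin : FiniteHistory φ c) (x : φ) :
    {y : φ | IsEdge φ c y x}.Finite :=
  ((hfin x x.2).preimage Subtype.val_injective.injOn).subset fun _ hy => hy.mem_ancestors

lemma FiniteHistory.finprod_edges_eq_zero (hfin : FiniteHistory φ c) {e : φ → ℤ} {x y : φ}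
    (hy : IsEdge φ c y x) (hey : e y = 1) :
    ∏ᶠ (z : φ) (_ : IsEdge φ c z x), (1 - e z) = 0 := by
  change ∏ᶠ z ∈ {z : φ | IsEdge φ c z x}, (1 - e z) = 0
  rw [finprod_mem_eq_finite_toFinset_prod _ (hfin.finite_edges x)]
  exact Finset.prod_eq_zero (i := y) (by simpa using hy) (by simp [hey])

/-- The number of ancestors decreases strictly along reversed edges. -/
lemma FiniteHistory.wellFounded (hfin : FiniteHistory φ c) :
    WellFounded (fun y x : φ => IsEdge φ c y x) :=
  Subrelation.wf (r := InvImage (· < ·) fun x : φ => (ancestors φ c x).ncard)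
    (fun {_ x} h => Set.ncard_lt_ncard h.ancestors_ssubset (hfin x x.2))
    (InvImage.wf _ wellFounded_lt)

lemma matern_subset (k : ℕ) : matern φ c k ⊆ φ := by
  cases k with
  | zero => exact subset_rfl
  | succ k => exact fun x hx => hx.1

/-- A point is kept in a step of the `k`-Matérn construction iff none of its parents was kept in
the step before. -/
lemma IsConflictRelation.mem_matern_succ (hc : IsConflictRelation φ c) {k : ℕ} {x : Point d}
    (hx : x ∈ φ) :
    x ∈ matern φ c (k + 1) ↔ ∀ y, IsEdge φ c y x → y ∉ matern φ c k := by
  constructor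
  · intro h y hy hyk
    exact (h.2 y hyk (hc.symm y hy.1 x hx hy.2.2.1)).not_gt hy.2.2.2
  · intro h
    refine ⟨hx, fun y hy hxy => ?_⟩
    have hyφ := matern_subset k hy
    refine lt_of_le_of_ne (not_lt.1 fun hlt => ?_) (hc.timer_ne x hx y hyφ hxy)
    exact h y ⟨hyφ, hx, hc.symm x hx y hyφ hxy, hlt⟩ hy

/-- The recursion for the indicator of the `∞`-Matérn set, in terms of sets. -/
lemma IsInftyIndicator.eq_one_iff (hfin : FiniteHistory φ c) {e : φ → ℤ}
    (he : IsInftyIndicator φ c e) (x : φ) :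
    e x = 1 ↔ ∀ y : φ, IsEdge φ c y x → e y ≠ 1 := by
  rcases Set.eq_empty_or_nonempty (ancestors φ c x) with h | h
  · simp only [he.of_no_ancestor x h, true_iff]
    intro y hy
    exact absurd hy.mem_ancestors (by simp [h])
  · rw [he.of_ancestor x h.ne_empty]
    constructor
    · intro hprod y hy hey
      exact zero_ne_one ((hfin.finprod_edges_eq_zero hy hey).symm.trans hprod)
    · intro hall
      refine finprod_mem_eq_one_of_forall_eq_one fun y hy => ?_
      simp [(he.zero_or_one y).resolve_right (hall y hy)]

lemma isInftyIndicator_of_iff (hfin : FiniteHistory φ c) {e : φ → ℤ}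
    (h01 : ∀ x, e x = 0 ∨ e x = 1)
    (h : ∀ x, e x = 1 ↔ ∀ y : φ, IsEdge φ c y x → e y ≠ 1) : IsInftyIndicator φ c e where
  zero_or_one := h01
  of_no_ancestor x hx := (h x).2 fun y hy => absurd hy.mem_ancestors (by simp [hx])
  of_ancestor x _ := by
    by_cases hx : ∀ y : φ, IsEdge φ c y x → e y ≠ 1
    · rw [(h x).2 hx]
      refine (finprod_mem_eq_one_of_forall_eq_one fun y hy => ?_).symm
      simp [(h01 y).resolve_right (hx y hy)]
    · rw [(h01 x).resolve_right (mt (h x).1 hx)]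
      push Not at hx
      obtain ⟨y, hy, hey⟩ := hx
      exact (hfin.finprod_edges_eq_zero hy hey).symm

lemma FiniteHistory.existsUnique_isInftyIndicator (hfin : FiniteHistory φ c) :
    ∃! e : φ → ℤ, IsInftyIndicator φ c e := by
  classical
  let F : (x : φ) → ((y : φ) → IsEdge φ c y x → ℤ) → ℤ :=
    fun x f => if ∀ (y : φ) (hy : IsEdge φ c y x), f y hy ≠ 1 then 1 else 0
  have hF : ∀ x, hfin.wellFounded.fix F x =
      if ∀ y : φ, IsEdge φ c y x → hfin.wellFounded.fix F y ≠ 1 then 1 else 0 :=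
    fun x => hfin.wellFounded.fix_eq F x
  refine ⟨hfin.wellFounded.fix F, isInftyIndicator_of_iff hfin (fun x => ?_) (fun x => ?_), ?_⟩
  · rw [hF]
    split_ifs <;> simp
  · conv_lhs => rw [hF]
    split_ifs with h
    · simpa using h
    · simpa using h
  · intro e he
    funext x
    induction x using hfin.wellFounded.induction with
    | _ x ih =>
      rw [hF]
      have := he.eq_one_iff hfin x
      split_ifs with h
      · exact this.2 fun y hy => by rw [ih y hy]; exact h y hy
      · refine (he.zero_or_one x).resolve_right fun hx => h fun y hy => ?_
        rw [← ih y hy]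
        exact this.1 hx y hy

lemma FiniteHistory.eventually_mem_matern_iff (hfin : FiniteHistory φ c)
    (hc : IsConflictRelation φ c) {e : φ → ℤ} (he : IsInftyIndicator φ c e) (x : φ) :
    ∀ᶠ k in atTop, ((x : Point d) ∈ matern φ c k ↔ e x = 1) := by
  induction x using hfin.wellFounded.induction with
  | _ x ih =>
    have hall := (eventually_all_finite (hfin.finite_edges x)).2 ih
    rw [← Filter.map_add_atTop_eq_nat 1]
    change ∀ᶠ k in atTop, ((x : Point d) ∈ matern φ c (k + 1) ↔ e x = 1)
    filter_upwards [hall] with k hk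
    rw [hc.mem_matern_succ x.2, he.eq_one_iff hfin]
    exact ⟨fun h y hy => (hk y hy).not.1 (h y hy),
      fun h y hy => (hk ⟨y, hy.1⟩ hy).not.2 (h ⟨y, hy.1⟩ hy)⟩

/-- The `∞`-Matérn set lies between the `k`-Matérn sets of odd and of even index. -/
lemma IsConflictRelation.matern_sandwich (hfin : FiniteHistory φ c)
    (hc : IsConflictRelation φ c) {e : φ → ℤ} (he : IsInftyIndicator φ c e) (k : ℕ) (x : φ) :
    (e x = 1 → (x : Point d) ∈ matern φ c (2 * k)) ∧
      ((x : Point d) ∈ matern φ c (2 * k + 1) → e x = 1) := by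
  have odd_of_even : ∀ k, (∀ x : φ, e x = 1 → (x : Point d) ∈ matern φ c (2 * k)) →
      ∀ x : φ, (x : Point d) ∈ matern φ c (2 * k + 1) → e x = 1 := by
    intro k h x hx
    rw [hc.mem_matern_succ x.2] at hx
    exact (he.eq_one_iff hfin x).2 fun y hy hey => hx y hy (h y hey)
  have even : ∀ k, ∀ x : φ, e x = 1 → (x : Point d) ∈ matern φ c (2 * k) := by
    intro k
    induction k with
    | zero => exact fun x _ => x.2
    | succ k ih =>
      intro x hx
      rw [show 2 * (k + 1) = (2 * k + 1) + 1 by ring, hc.mem_matern_succ x.2]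
      exact fun y hy hyk => (he.eq_one_iff hfin x).1 hx ⟨y, hy.1⟩ hy (odd_of_even k ih _ hyk)
  exact ⟨even k x, odd_of_even k (even k) x⟩

theorem FiniteHistory.matern_limit (hfin : FiniteHistory φ c) (hc : IsConflictRelation φ c) :
    (∀ e : φ → ℤ, IsInftyIndicator φ c e → ∀ x : φ,
      Tendsto (fun k : ℕ => (matern φ c k).indicator (fun _ => (1 : ℤ)) (x : Point d))
        atTop (𝓝 (e x))) ∧
    (⋃ k : ℕ, matern φ c (2 * k + 1)) = maternInfty φ c ∧
    (⋂ k : ℕ, matern φ c (2 * k)) = maternInfty φ c := by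
  refine ⟨fun e he x => ?_, ?_⟩
  · refine tendsto_const_nhds.congr' ?_
    filter_upwards [hfin.eventually_mem_matern_iff hc he x] with k hk
    rcases he.zero_or_one x with h | h
    · rw [h, Set.indicator_of_notMem (fun hx => by simp [hk.1 hx] at h)]
    · rw [h, Set.indicator_of_mem (hk.2 h)]
  obtain ⟨e, he, huniq⟩ := hfin.existsUnique_isInftyIndicator
  have hmem : ∀ x : φ, (x : Point d) ∈ maternInfty φ c ↔ e x = 1 := fun x =>
    ⟨fun ⟨e', he', _, h⟩ => huniq e' he' ▸ h, fun h => ⟨e, he, x.2, h⟩⟩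
  have hsub : maternInfty φ c ⊆ φ := fun x ⟨_, _, hx, _⟩ => hx
  refine ⟨Set.Subset.antisymm (Set.iUnion_subset fun k x hx => ?_) fun x hx => ?_,
    Set.Subset.antisymm (fun x hx => ?_) (Set.subset_iInter fun k x hx => ?_)⟩
  · exact (hmem ⟨x, hx.1⟩).2 ((hc.matern_sandwich hfin he k ⟨x, hx.1⟩).2 hx)
  · obtain ⟨N, hN⟩ := eventually_atTop.1 (hfin.eventually_mem_matern_iff hc he ⟨x, hsub hx⟩)
    exact Set.mem_iUnion.2 ⟨N, (hN (2 * N + 1) (by lia)).2 ((hmem ⟨x, hsub hx⟩).1 hx)⟩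
  · have hxφ : x ∈ φ := matern_subset _ (Set.mem_iInter.1 hx 0)
    obtain ⟨N, hN⟩ := eventually_atTop.1 (hfin.eventually_mem_matern_iff hc he ⟨x, hxφ⟩)
    exact (hmem ⟨x, hxφ⟩).2 ((hN (2 * N) (by lia)).1 (Set.mem_iInter.1 hx N))
  · exact (hc.matern_sandwich hfin he k ⟨x, hsub hx⟩).1 ((hmem ⟨x, hsub hx⟩).1 hx)

end Graph

/-! ### Moments of the Poisson distribution -/

lemma lintegral_poissonMeasure (r : ℝ≥0) : ∫⁻ n, (n : ℝ≥0∞) ∂poissonMeasure r = r := by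
  have hterm : ∀ n : ℕ, ENNReal.ofReal (Real.exp (-r) * r ^ (n + 1) / (n + 1).factorial) *
      ((n + 1 : ℕ) : ℝ≥0∞) = r * poissonMeasure r {n} := by
    intro n
    rw [poissonMeasure_singleton, ← ENNReal.ofReal_natCast, ← ENNReal.ofReal_coe_nnreal,
      ← ENNReal.ofReal_mul (by positivity), ← ENNReal.ofReal_mul (by positivity)]
    congr 1
    rw [Nat.factorial_succ]
    push_cast
    field_simp
    ring
  have hsum : ∑' n, poissonMeasure r {n} = 1 := by
    simpa using (lintegral_countable' (μ := poissonMeasure r) 1).symm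
  rw [lintegral_countable']
  rw [tsum_eq_zero_add' ENNReal.summable]
  simp_rw [poissonMeasure_singleton r (_ + 1), mul_comm ((_ : ℕ) : ℝ≥0∞)]
  simp_rw [hterm, ENNReal.tsum_mul_left, hsum]
  simp

lemma poissonMeasure_two_le (r : ℝ≥0) : poissonMeasure r {n | 2 ≤ n} ≤ (r : ℝ≥0∞) ^ 2 := by
  have hset : {n : ℕ | 2 ≤ n} = ({0, 1} : Set ℕ)ᶜ := by
    ext n
    simp only [Set.mem_ofPred_eq, Set.mem_compl_iff, Set.mem_insert_iff, Set.mem_singleton_iff]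
    lia
  have h01 : (poissonMeasure r).real {0, 1} = Real.exp (-r) + Real.exp (-r) * r := by
    rw [Set.insert_eq, measureReal_union (by simp) (by simp), poissonMeasure_real_singleton,
      poissonMeasure_real_singleton]
    simp
  rw [← ENNReal.ofReal_coe_nnreal (p := r), ← ENNReal.ofReal_pow (NNReal.coe_nonneg r), hset,
    ← ofReal_measureReal,
    probReal_compl_eq_one_sub (by measurability), h01]
  refine ENNReal.ofReal_le_ofReal ?_
  nlinarith [Real.add_one_le_exp (-(r : ℝ)), r.2]

/-! ### Sums over tuples of points -/

lemma prod_tsum_eq_tsum_prod : ∀ (n : ℕ) (f : Fin n → ℕ → ℝ≥0∞),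
    ∏ k, ∑' j, f k j = ∑' i : Fin n → ℕ, ∏ k, f k (i k)
  | 0, f => by simp
  | n + 1, f => by
    rw [Fin.prod_univ_succ, prod_tsum_eq_tsum_prod n, ← (Fin.consEquiv fun _ => ℕ).tsum_eq,
      ENNReal.tsum_prod', ← ENNReal.tsum_mul_right]
    simp [Fin.consEquiv, Fin.prod_univ_succ, ENNReal.tsum_mul_left]

section Tuples

variable {Ω α : Type*} [MeasurableSpace Ω] [MeasurableSpace α] {P : Measure Ω}
  {Φ : Ω → Set α} {κ : Ω → ℕ∞} {X : ℕ → Ω → α} {μ : Measure α}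

/-- The event that all the listed points with indices `i 0, …, i (n - 1)` exist. -/
def tupleExists (κ : Ω → ℕ∞) {n : ℕ} (i : Fin n → ℕ) : Set Ω :=
  {ω | ∀ k, (i k : ℕ∞) < κ ω}

/-- The intensity measure of the `n`-tuples of points: the mass of `A` is the expected number of
`n`-tuples of listed points (with repetitions) that lie in `A`. -/
noncomputable def tupleMeasure (P : Measure Ω) (κ : Ω → ℕ∞) (X : ℕ → Ω → α) (n : ℕ) :
    Measure (Fin n → α) :=
  Measure.sum fun i : Fin n → ℕ => (P.restrict (tupleExists κ i)).map fun ω k => X (i k) ω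

lemma IsListing.encard_inter (hL : IsListing P Φ κ X) (B : Set α) :
    ∀ᵐ ω ∂P, ((Φ ω ∩ B).encard : ℝ≥0∞) =
      ∑' j : ℕ, {ω | (j : ℕ∞) < κ ω ∧ X j ω ∈ B}.indicator 1 ω := by
  filter_upwards [hL.bijOn] with ω hω
  have himg : Φ ω ∩ B = (fun j => X j ω) '' {j : ℕ | (j : ℕ∞) < κ ω ∧ X j ω ∈ B} := by
    rw [← hω.image_eq]
    ext x
    constructor
    · rintro ⟨⟨j, hj, rfl⟩, hx⟩
      exact ⟨j, ⟨hj, hx⟩, rfl⟩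
    · rintro ⟨j, ⟨hj, hx⟩, rfl⟩
      exact ⟨⟨j, hj, rfl⟩, hx⟩
  rw [himg, (hω.injOn.mono fun j hj => hj.1).encard_image, ← ENNReal.tsum_set_one,
    tsum_subtype _ fun _ => (1 : ℝ≥0∞)]
  rfl

lemma IsListing.tupleMeasure_pi (hL : IsListing P Φ κ X) {n : ℕ} {B : Fin n → Set α}
    (hB : ∀ k, MeasurableSet (B k)) :
    tupleMeasure P κ X n (Set.univ.pi B) = ∫⁻ ω, ∏ k, ((Φ ω ∩ B k).encard : ℝ≥0∞) ∂P := by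
  have hmeas : ∀ i : Fin n → ℕ, Measurable fun ω k => X (i k) ω :=
    fun i => measurable_pi_lambda _ fun k => hL.measurable_point _
  have hset : ∀ (k : Fin n) (j : ℕ), MeasurableSet {ω | (j : ℕ∞) < κ ω ∧ X j ω ∈ B k} := fun k j =>
    (hL.measurable_card (t := Set.Ioi _) .of_discrete).inter (hL.measurable_point j (hB k))
  have hae : ∀ᵐ ω ∂P, ∏ k, ((Φ ω ∩ B k).encard : ℝ≥0∞) =
      ∑' i : Fin n → ℕ, ∏ k, {ω | (i k : ℕ∞) < κ ω ∧ X (i k) ω ∈ B k}.indicator 1 ω := by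
    filter_upwards [ae_all_iff.2 fun k => hL.encard_inter (B k)] with ω hω
    simp_rw [hω]
    exact prod_tsum_eq_tsum_prod n _
  rw [lintegral_congr_ae hae, lintegral_tsum fun i =>
    (Finset.measurable_fun_prod _ fun k _ => measurable_one.indicator (hset k _)).aemeasurable,
    tupleMeasure, Measure.sum_apply _ (MeasurableSet.univ_pi hB)]
  refine tsum_congr fun i => ?_
  rw [Measure.map_apply (hmeas i) (.univ_pi hB),
    Measure.restrict_apply (hmeas i (.univ_pi hB))]
  have hind : ∀ ω, ∏ k, {ω | (i k : ℕ∞) < κ ω ∧ X (i k) ω ∈ B k}.indicator (1 : Ω → ℝ≥0∞) ω =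
      (⋂ k, {ω | (i k : ℕ∞) < κ ω ∧ X (i k) ω ∈ B k}).indicator 1 ω := by
    intro ω
    classical
    simp only [Set.indicator_apply, Pi.one_apply, Set.mem_iInter, Finset.prod_boole,
      Finset.mem_univ, true_imp_iff]
  simp_rw [hind]
  rw [lintegral_indicator_one (.iInter fun k => hset k _)]
  congr 1
  ext ω
  simp only [tupleExists, Set.mem_inter_iff, Set.mem_preimage, Set.mem_univ_pi, Set.mem_ofPred_eq,
    Set.mem_iInter]
  exact ⟨fun h k => ⟨h.2 k, h.1 k⟩, fun h => ⟨fun k => (h k).2, fun k => (h k).1⟩⟩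

lemma IsPoissonProcess.lintegral_encard (hΦ : IsPoissonProcess P μ Φ) {B : Set α}
    (hB : MeasurableSet B) (hfin : μ B < ∞) :
    ∫⁻ ω, ((Φ ω ∩ B).encard : ℝ≥0∞) ∂P = μ B := by
  have hlaw := hΦ.hasLaw_count B hB hfin
  have hmeas : Measurable ((↑) : ℕ∞ → ℝ≥0∞) := .of_discrete
  rw [← lintegral_map' (f := ((↑) : ℕ∞ → ℝ≥0∞)) hmeas.aemeasurable hlaw.aemeasurable,
    hlaw.map_eq, lintegral_map hmeas .of_discrete]
  simp [lintegral_poissonMeasure, ENNReal.coe_toNNReal hfin.ne]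

/-- On a product of disjoint sets the intensity measure of the tuples of points is the product
of the intensity measure: only the independence of the counts and their means matter. -/
lemma IsPoissonProcess.tupleMeasure_restrict_pi [SigmaFinite μ] (hΦ : IsPoissonProcess P μ Φ)
    (hL : IsListing P Φ κ X) {n : ℕ} {S : Fin n → Set α} (hS : ∀ k, MeasurableSet (S k))
    (hfin : ∀ k, μ (S k) < ∞) (hdisj : Pairwise fun k l => Disjoint (S k) (S l)) :
    (tupleMeasure P κ X n).restrict (Set.univ.pi S) =
      (Measure.pi fun _ => μ).restrict (Set.univ.pi S) := by
  rw [Measure.restrict_pi_pi]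
  refine (Measure.pi_eq fun B hB => ?_).symm
  have hBS : ∀ k, MeasurableSet (B k ∩ S k) := fun k => (hB k).inter (hS k)
  have hBfin : ∀ k, μ (B k ∩ S k) < ∞ :=
    fun k => (measure_mono Set.inter_subset_right).trans_lt (hfin k)
  rw [Measure.restrict_apply (.univ_pi hB), ← Set.pi_inter_distrib, hL.tupleMeasure_pi hBS]
  have hlaw := fun k => hΦ.hasLaw_count _ (hBS k) (hBfin k)
  have hind := hΦ.indep_count n (fun k => B k ∩ S k) hBS fun k l hkl =>
    (hdisj hkl).mono Set.inter_subset_right Set.inter_subset_right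
  have hae : ∀ k, (fun ω => (Φ ω ∩ (B k ∩ S k)).encard) =ᵐ[P] (hlaw k).aemeasurable.mk _ :=
    fun k => (hlaw k).aemeasurable.ae_eq_mk
  have hmeas : Measurable ((↑) : ℕ∞ → ℝ≥0∞) := .of_discrete
  have hprod := lintegral_prod_eq_prod_lintegral_of_indepFun Finset.univ
    (fun k => ((↑) : ℕ∞ → ℝ≥0∞) ∘ (hlaw k).aemeasurable.mk _)
    ((hind.congr hae).comp (fun _ => ((↑) : ℕ∞ → ℝ≥0∞)) fun _ => hmeas)
    fun k => hmeas.comp (hlaw k).aemeasurable.measurable_mk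
  have hall : ∀ᵐ ω ∂P, ∀ k, (Φ ω ∩ (B k ∩ S k)).encard = (hlaw k).aemeasurable.mk _ ω :=
    ae_all_iff.2 hae
  rw [lintegral_congr_ae (g := fun ω => ∏ k, ((hlaw k).aemeasurable.mk _ ω : ℝ≥0∞))
    (by filter_upwards [hall] with ω hω; simp [hω])]
  refine hprod.trans (Finset.prod_congr rfl fun k _ => ?_)
  rw [Measure.restrict_apply (hB k)]
  refine Eq.trans (lintegral_congr_ae ?_) (hΦ.lintegral_encard (hBS k) (hBfin k))
  filter_upwards [hall] with ω hω
  simp [hω]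

/-- On the tuples of points with distinct timers, the intensity measure of the tuples of points of
a Poisson process is the product of the intensity measure. -/
lemma IsPoissonProcess.tupleMeasure_restrict_injective [SigmaFinite μ]
    (hΦ : IsPoissonProcess P μ Φ) (hL : IsListing P Φ κ X) {τ : α → ℝ≥0} (hτ : Measurable τ)
    (n : ℕ) :
    (tupleMeasure P κ X n).restrict {z | Function.Injective fun k => τ (z k)} =
      (Measure.pi fun _ => μ).restrict {z | Function.Injective fun k => τ (z k)} := by
  -- Cells of a time grid with pairwise distinct indices are disjoint, and products of such cells
  -- cover the tuples with distinct timers.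
  let S : ℕ → ℕ → Set α := fun m N => spanningSets μ m ∩ {x | ⌊τ x * m⌋₊ = N}
  let I := {q : ℕ × (Fin n → ℕ) // Function.Injective q.2}
  have hSmeas : ∀ m N, MeasurableSet (S m N) := fun m N =>
    (measurableSet_spanningSets μ m).inter
      ((Nat.measurable_floor.comp (hτ.mul_const (m : ℝ≥0))) (measurableSet_singleton N))
  have hcover : {z : Fin n → α | Function.Injective fun k => τ (z k)} ⊆
      ⋃ q : I, Set.univ.pi fun k => S q.1.1 (q.1.2 k) := by
    intro z hz
    have hspan : ∀ k, ∀ᶠ m in atTop, z k ∈ spanningSets μ m := by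
      intro k
      have hk : z k ∈ ⋃ m, spanningSets μ m := by simp [iUnion_spanningSets]
      obtain ⟨m₀, hm₀⟩ := Set.mem_iUnion.1 hk
      exact eventually_atTop.2 ⟨m₀, fun m hm => monotone_spanningSets μ hm hm₀⟩
    have hsep : ∀ k l, k ≠ l → ∀ᶠ m : ℕ in atTop, ⌊τ (z k) * m⌋₊ ≠ ⌊τ (z l) * m⌋₊ := by
      have hlt : ∀ s t : ℝ≥0, s < t → ∀ᶠ m : ℕ in atTop, ⌊s * m⌋₊ ≠ ⌊t * m⌋₊ := by
        intro s t hst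
        obtain ⟨m₀, hm₀⟩ := exists_nat_gt (t - s)⁻¹
        refine eventually_atTop.2 ⟨m₀, fun m hm => (Nat.lt_of_lt_of_le (Nat.lt_succ_self _) ?_).ne⟩
        refine Nat.le_floor ?_
        have h1 : (1 : ℝ≥0) ≤ (t - s) * m := by
          have hpos : 0 < t - s := tsub_pos_of_lt hst
          have hle : (t - s)⁻¹ ≤ m := hm₀.le.trans (by exact_mod_cast hm)
          calc (1 : ℝ≥0) = (t - s) * (t - s)⁻¹ := (mul_inv_cancel₀ hpos.ne').symm
            _ ≤ _ := by gcongr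
        calc ((⌊s * m⌋₊.succ : ℕ) : ℝ≥0) = ⌊s * m⌋₊ + 1 := by push_cast; rfl
          _ ≤ s * m + (t - s) * m := add_le_add (Nat.floor_le zero_le) h1
          _ = t * m := by rw [← add_mul, add_tsub_cancel_of_le hst.le]
      intro k l hkl
      rcases lt_or_gt_of_ne (hz.ne hkl) with h | h
      · exact hlt _ _ h
      · exact (hlt _ _ h).mono fun m hm => hm.symm
    obtain ⟨m, hm, hm'⟩ := ((eventually_all.2 hspan).and (eventually_all.2 fun k =>
      eventually_all.2 fun l => eventually_imp_distrib_left.2 (hsep k l))).exists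
    refine Set.mem_iUnion.2 ⟨⟨(m, fun k => ⌊τ (z k) * m⌋₊), fun k l hkl => ?_⟩, fun k _ => ?_⟩
    · by_contra hne
      exact hm' k l hne hkl
    · exact ⟨hm k, rfl⟩
  have hunion : (tupleMeasure P κ X n).restrict
      (⋃ q : I, Set.univ.pi fun k => S q.1.1 (q.1.2 k)) =
      (Measure.pi fun _ => μ).restrict (⋃ q : I, Set.univ.pi fun k => S q.1.1 (q.1.2 k)) := by
    refine Measure.restrict_iUnion_congr.2 fun q => ?_
    refine hΦ.tupleMeasure_restrict_pi hL (fun k => hSmeas _ _) (fun k => ?_) fun k l hkl => ?_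
    · exact (measure_mono Set.inter_subset_left).trans_lt (measure_spanningSets_lt_top μ _)
    · refine Set.disjoint_left.2 fun x hx hx' => hkl (q.2 ?_)
      exact hx.2.symm.trans hx'.2
  exact Measure.restrict_congr_mono hcover hunion

end Tuples

/-! ### Lebesgue measure on the half-line -/

lemma measurableEmbedding_nnreal_coe : MeasurableEmbedding ((↑) : ℝ≥0 → ℝ) :=
  .subtype_coe measurableSet_Ici

instance : SigmaFinite timeMeasure := by
  unfold timeMeasure
  have : IsFiniteMeasureOnCompacts (Measure.comap ((↑) : ℝ≥0 → ℝ) volume) :=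
    .comap' _ NNReal.continuous_coe measurableEmbedding_nnreal_coe
  infer_instance

lemma timeMeasure_Ico (a b : ℝ≥0) : timeMeasure (Set.Ico a b) = b - a := by
  have himg : ((↑) : ℝ≥0 → ℝ) '' Set.Ico a b = Set.Ico (a : ℝ) b := by
    ext t
    constructor
    · rintro ⟨s, hs, rfl⟩
      exact hs
    · intro ht
      exact ⟨⟨t, a.2.trans ht.1⟩, ht, rfl⟩
  rw [timeMeasure, measurableEmbedding_nnreal_coe.comap_apply, himg, Real.volume_Ico,
    ENNReal.ofReal_sub _ (NNReal.coe_nonneg a), ENNReal.ofReal_coe_nnreal, ENNReal.ofReal_coe_nnreal]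

lemma lintegral_exp_timeMeasure_le {a : ℝ} (ha : 0 < a) (t : ℝ≥0) :
    ∫⁻ s, (if s < t then ENNReal.ofReal (Real.exp (a * s)) else 0) ∂timeMeasure ≤
      ENNReal.ofReal (a⁻¹) * ENNReal.ofReal (Real.exp (a * t)) := by
  have hmap : timeMeasure.map ((↑) : ℝ≥0 → ℝ) ≤ volume := by
    rw [timeMeasure, measurableEmbedding_nnreal_coe.map_comap]
    exact Measure.restrict_le_self
  calc ∫⁻ s, (if s < t then ENNReal.ofReal (Real.exp (a * s)) else 0) ∂timeMeasure
      ≤ ∫⁻ s : ℝ≥0, (Set.Iic (t : ℝ)).indicator (fun s => ENNReal.ofReal (Real.exp (a * s))) s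
          ∂timeMeasure := by
        refine lintegral_mono fun s => ?_
        split_ifs with hs
        · rw [Set.indicator_of_mem (by exact_mod_cast hs.le)]
        · exact zero_le
    _ = ∫⁻ s, (Set.Iic (t : ℝ)).indicator (fun s => ENNReal.ofReal (Real.exp (a * s))) s
          ∂timeMeasure.map ((↑) : ℝ≥0 → ℝ) := (measurableEmbedding_nnreal_coe.lintegral_map _).symm
    _ ≤ ∫⁻ s in Set.Iic (t : ℝ), ENNReal.ofReal (Real.exp (a * s)) := by
        rw [← lintegral_indicator measurableSet_Iic]
        exact lintegral_mono' hmap le_rfl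
    _ = _ := by
        rw [← ofReal_integral_eq_lintegral_ofReal (integrableOn_exp_mul_Iic ha _)
          (ae_of_all _ fun _ => (Real.exp_pos _).le), integral_exp_mul_Iic ha,
          ← ENNReal.ofReal_mul (by positivity)]
        congr 1
        field_simp

/-! ### The timers are almost surely distinct -/

section Ties

variable {d : ℕ} {Ω : Type*} [MeasurableSpace Ω] {P : Measure Ω}
  {Λ : Measure (EuclideanSpace ℝ (Fin d))} {Φ : Ω → Set (Point d)}

lemma IsPoissonProcess.measure_two_le_encard {α : Type*} [MeasurableSpace α] {μ : Measure α}
    {Φ : Ω → Set α} (hΦ : IsPoissonProcess P μ Φ) {B : Set α} (hB : MeasurableSet B)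
    (hfin : μ B < ∞) : P {ω | 2 ≤ (Φ ω ∩ B).encard} ≤ μ B ^ 2 := by
  rw [(hΦ.hasLaw_count B hB hfin).measure_eq (p := fun n => 2 ≤ n) .of_discrete,
    Measure.map_apply .of_discrete .of_discrete]
  have hset : ((↑) : ℕ → ℕ∞) ⁻¹' {n | 2 ≤ n} = {n | 2 ≤ n} := by
    ext n
    simp
  rw [hset]
  simpa [ENNReal.coe_toNNReal hfin.ne] using poissonMeasure_two_le (μ B).toNNReal

lemma IsPoissonProcess.ae_timer_ne_of_finite (hΦ : IsPoissonProcess P (Λ.prod timeMeasure) Φ)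
    {S : Set (EuclideanSpace ℝ (Fin d))} (hS : MeasurableSet S) (hfin : Λ S < ∞) (T : ℕ) :
    ∀ᵐ ω ∂P, ∀ x ∈ Φ ω, ∀ y ∈ Φ ω, x.1 ∈ S → y.1 ∈ S → x.2 < T → x.2 = y.2 → x = y := by
  -- Cut `[0, T)` into `T * m` intervals of length `1 / m`: two points with the same timer lie over
  -- the same interval, and the expected number of intervals with two points is of order `1 / m`.
  let B : ℕ → ℕ → Set (Point d) := fun m N =>
    S ×ˢ Set.Ico ((N : ℝ≥0) / (m + 1 : ℕ)) ((N + 1 : ℕ) / (m + 1 : ℕ) : ℝ≥0)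
  have hBmeas : ∀ m N, MeasurableSet (B m N) := fun m N => hS.prod measurableSet_Ico
  have hμB : ∀ m N, (Λ.prod timeMeasure) (B m N) = Λ S * ((m + 1 : ℕ) : ℝ≥0∞)⁻¹ := by
    intro m N
    rw [Measure.prod_prod, timeMeasure_Ico, ← ENNReal.coe_sub, ← NNReal.sub_div]
    congr 1
    rw [show ((N + 1 : ℕ) : ℝ≥0) - N = 1 by push_cast; exact add_tsub_cancel_left _ _, one_div,
      ENNReal.coe_inv (by positivity), ENNReal.coe_natCast]
  have hμfin : ∀ m N, (Λ.prod timeMeasure) (B m N) < ∞ := by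
    intro m N
    rw [hμB]
    exact ENNReal.mul_lt_top hfin (ENNReal.inv_lt_top.2 (by positivity))
  have hbound : ∀ m : ℕ, P {ω | ¬ ∀ x ∈ Φ ω, ∀ y ∈ Φ ω, x.1 ∈ S → y.1 ∈ S → x.2 < T →
      x.2 = y.2 → x = y} ≤ T * Λ S ^ 2 * ((m + 1 : ℕ) : ℝ≥0∞)⁻¹ := by
    intro m
    calc _ ≤ P (⋃ N ∈ Finset.range (T * (m + 1)), {ω | 2 ≤ (Φ ω ∩ B m N).encard}) := by
          refine measure_mono fun ω hω => ?_
          simp only [Set.mem_ofPred_eq] at hω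
          push Not at hω
          obtain ⟨x, hx, y, hy, hxS, hyS, hxT, hxy, hne⟩ := hω
          have hm : (0 : ℝ≥0) < (m + 1 : ℕ) := by positivity
          set N := ⌊x.2 * (m + 1 : ℕ)⌋₊ with hN
          have hmem : x.2 ∈ Set.Ico ((N : ℝ≥0) / (m + 1 : ℕ)) ((N + 1 : ℕ) / (m + 1 : ℕ)) := by
            refine ⟨(div_le_iff₀ hm).2 (Nat.floor_le zero_le), (lt_div_iff₀ hm).2 ?_⟩
            exact_mod_cast Nat.lt_floor_add_one (x.2 * (m + 1 : ℕ))
          have hNT : N < T * (m + 1) := by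
            rw [hN, Nat.floor_lt zero_le, Nat.cast_mul]
            exact mul_lt_mul_of_pos_right hxT hm
          simp only [Set.mem_iUnion, Finset.mem_range]
          refine ⟨N, hNT, ?_⟩
          have hsub : ({x, y} : Set (Point d)) ⊆ Φ ω ∩ B m N := by
            rintro z (rfl | rfl)
            · exact ⟨hx, hxS, hmem⟩
            · exact ⟨hy, hyS, hxy ▸ hmem⟩
          exact (Set.encard_pair hne).symm.le.trans (Set.encard_le_encard hsub)
      _ ≤ ∑ N ∈ Finset.range (T * (m + 1)), P {ω | 2 ≤ (Φ ω ∩ B m N).encard} :=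
          measure_biUnion_finset_le _ _
      _ ≤ ∑ N ∈ Finset.range (T * (m + 1)), (Λ S * ((m + 1 : ℕ) : ℝ≥0∞)⁻¹) ^ 2 :=
          Finset.sum_le_sum fun N _ =>
            (hΦ.measure_two_le_encard (hBmeas m N) (hμfin m N)).trans_eq (by rw [hμB])
      _ = T * Λ S ^ 2 * ((m + 1 : ℕ) : ℝ≥0∞)⁻¹ * (((m + 1 : ℕ) : ℝ≥0∞) * ((m + 1 : ℕ) : ℝ≥0∞)⁻¹) := by
          rw [Finset.sum_const, Finset.card_range, nsmul_eq_mul]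
          push_cast
          ring
      _ = _ := by
          rw [ENNReal.mul_inv_cancel (by positivity) (ENNReal.natCast_ne_top _), mul_one]
  have hlim : Tendsto (fun m : ℕ => (T : ℝ≥0∞) * Λ S ^ 2 * ((m + 1 : ℕ) : ℝ≥0∞)⁻¹) atTop (𝓝 0) := by
    have h := ENNReal.Tendsto.const_mul (a := (T : ℝ≥0∞) * Λ S ^ 2)
      ((tendsto_add_atTop_iff_nat 1).2 ENNReal.tendsto_inv_nat_nhds_zero)
      (Or.inr (ENNReal.mul_ne_top (ENNReal.natCast_ne_top _) (ENNReal.pow_ne_top hfin.ne)))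
    simpa using h
  exact le_antisymm (ge_of_tendsto' hlim hbound) zero_le

lemma IsPoissonProcess.ae_timer_injOn [SigmaFinite Λ]
    (hΦ : IsPoissonProcess P (Λ.prod timeMeasure) Φ) :
    ∀ᵐ ω ∂P, (Φ ω).InjOn Prod.snd := by
  have hall : ∀ᵐ ω ∂P, ∀ m T : ℕ, ∀ x ∈ Φ ω, ∀ y ∈ Φ ω, x.1 ∈ spanningSets Λ m →
      y.1 ∈ spanningSets Λ m → x.2 < T → x.2 = y.2 → x = y :=
    ae_all_iff.2 fun m => ae_all_iff.2 fun T => hΦ.ae_timer_ne_of_finite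
      (measurableSet_spanningSets Λ m) (measure_spanningSets_lt_top Λ m) T
  filter_upwards [hall] with ω hω x hx y hy hxy
  have hspan : ∀ z : EuclideanSpace ℝ (Fin d), ∃ m, z ∈ spanningSets Λ m := fun z =>
    Set.mem_iUnion.1 (by simp [iUnion_spanningSets])
  obtain ⟨m, hm⟩ := hspan x.1
  obtain ⟨m', hm'⟩ := hspan y.1
  obtain ⟨T, hT⟩ := exists_nat_gt x.2
  exact hω (max m m') T x hx y hy (monotone_spanningSets Λ (le_max_left _ _) hm)
    (monotone_spanningSets Λ (le_max_right _ _) hm') hT hxy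

end Ties

/-! ### The expected number of chains -/

section Chains

/-- The weight of a chain `z 0, …, z n` is the product of the weights `g` of its steps. -/
noncomputable def chainWeight {α : Type*} (g : α → α → ℝ≥0∞) {n : ℕ} (z : Fin (n + 1) → α) : ℝ≥0∞ :=
  ∏ k : Fin n, g (z k.castSucc) (z k.succ)

lemma chainWeight_cons {α : Type*} (g : α → α → ℝ≥0∞) {n : ℕ} (x : α) (z : Fin (n + 1) → α) :
    chainWeight g (Fin.cons x z : Fin (n + 2) → α) = g x (z 0) * chainWeight g z := by
  simp [chainWeight, Fin.prod_univ_succ]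


variable {α : Type*} [MeasurableSpace α] {μ : Measure α} [SigmaFinite μ]

lemma measurable_chainWeight {g : α → α → ℝ≥0∞} (hg : Measurable (Function.uncurry g)) (n : ℕ) :
    Measurable (chainWeight g : (Fin (n + 1) → α) → ℝ≥0∞) := by
  refine Finset.measurable_fun_prod _ fun k _ => ?_
  exact hg.comp (f := fun z : Fin (n + 1) → α => (z k.castSucc, z k.succ))
    ((measurable_pi_apply _).prodMk (measurable_pi_apply _))

lemma lintegral_pi_fin_succ {n : ℕ} {f : (Fin (n + 1) → α) → ℝ≥0∞} (hf : Measurable f) :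
    ∫⁻ z, f z ∂(Measure.pi fun _ => μ) =
      ∫⁻ x, ∫⁻ z : Fin n → α, f (Fin.cons x z) ∂(Measure.pi fun _ => μ) ∂μ := by
  have hmp := (measurePreserving_piFinSuccAbove (fun _ : Fin (n + 1) => μ) 0).symm
  rw [← hmp.lintegral_comp hf]
  refine (lintegral_prod _ (hf.comp hmp.measurable).aemeasurable).trans ?_
  simp [MeasurableEquiv.piFinSuccAbove_symm_apply, Fin.insertNthEquiv]

/-- If `w ≥ 1` is multiplied by at most `r` by the integral operator of kernel `g`, then the chains
of `n` steps from `x` have total weight at most `r ^ n * w x`. -/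
lemma lintegral_chainWeight_cons_le {g : α → α → ℝ≥0∞} (hg : Measurable (Function.uncurry g))
    {w : α → ℝ≥0∞} (hw : ∀ x, 1 ≤ w x) {r : ℝ≥0∞}
    (hr : ∀ x, ∫⁻ y, g x y * w y ∂μ ≤ r * w x) (hrtop : r ≠ ∞) (n : ℕ) (x : α) :
    ∫⁻ z : Fin n → α, chainWeight g (Fin.cons x z : Fin (n + 1) → α) ∂(Measure.pi fun _ => μ) ≤
      r ^ n * w x := by
  have hcons : ∀ (n : ℕ) (x : α), Measurable fun z : Fin n → α => (Fin.cons x z : Fin (n + 1) → α) :=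
    fun n x => measurable_pi_lambda _ fun k => by
      refine Fin.cases ?_ (fun k => ?_) k
      · simp
      · simpa using measurable_pi_apply k
  induction n generalizing x with
  | zero => simpa [chainWeight] using hw x
  | succ n ih =>
    rw [lintegral_pi_fin_succ (f := fun z => chainWeight g (Fin.cons x z : Fin (n + 2) → α))
      ((measurable_chainWeight hg _).comp (hcons _ x))]
    calc _ = ∫⁻ y, g x y * ∫⁻ z : Fin n → α, chainWeight g (Fin.cons y z : Fin (n + 1) → α)
            ∂(Measure.pi fun _ => μ) ∂μ := by
          refine lintegral_congr fun y => ?_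
          simp_rw [chainWeight_cons, Fin.cons_zero]
          exact lintegral_const_mul _ ((measurable_chainWeight hg _).comp (hcons _ y))
      _ ≤ ∫⁻ y, r ^ n * (g x y * w y) ∂μ := by
          refine lintegral_mono fun y => ?_
          rw [mul_left_comm]
          gcongr
          exact ih y
      _ = r ^ n * ∫⁻ y, g x y * w y ∂μ := lintegral_const_mul' _ _ (ENNReal.pow_ne_top hrtop)
      _ ≤ r ^ n * (r * w x) := by gcongr; exact hr x
      _ = r ^ (n + 1) * w x := by ring

lemma lintegral_chainWeight_le {g : α → α → ℝ≥0∞} (hg : Measurable (Function.uncurry g))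
    {w : α → ℝ≥0∞} (hw : ∀ x, 1 ≤ w x) {r : ℝ≥0∞}
    (hr : ∀ x, ∫⁻ y, g x y * w y ∂μ ≤ r * w x) (hrtop : r ≠ ∞) {A : Set α} (hA : MeasurableSet A)
    (n : ℕ) :
    ∫⁻ z : Fin (n + 1) → α, A.indicator 1 (z 0) * chainWeight g z ∂(Measure.pi fun _ => μ) ≤
      r ^ n * ∫⁻ x in A, w x ∂μ := by
  have hmeas : Measurable fun z : Fin (n + 1) → α => A.indicator (1 : α → ℝ≥0∞) (z 0) :=
    (measurable_one.indicator hA).comp (measurable_pi_apply 0)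
  rw [lintegral_pi_fin_succ (f := fun z => A.indicator 1 (z 0) * chainWeight g z)
    (hmeas.mul (measurable_chainWeight hg n)),
    ← lintegral_const_mul' _ _ (ENNReal.pow_ne_top hrtop), ← lintegral_indicator hA]
  refine lintegral_mono fun x => ?_
  simp only [Fin.cons_zero]
  by_cases hx : x ∈ A
  · simpa [hx] using lintegral_chainWeight_cons_le hg hw hr hrtop n x
  · simp [hx]

end Chains

/-! ### Conditioning on the points -/

section Conditioning

lemma measurableSet_listingSigma_tuple {Ω α : Type*} [MeasurableSpace α] {κ : Ω → ℕ∞}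
    {X : ℕ → Ω → α} {n : ℕ} (i : Fin n → ℕ) {D : Set (Fin n → α)}
    (hD : MeasurableSet D) :
    MeasurableSet[listingSigma κ X] (tupleExists κ i ∩ (fun ω k => X (i k) ω) ⁻¹' D) := by
  have hκ : Measurable[listingSigma κ X] κ := (comap_measurable κ).mono le_sup_left le_rfl
  have hX : ∀ j, Measurable[listingSigma κ X] (X j) := fun j =>
    (comap_measurable (X j)).mono
      ((le_iSup (fun n => MeasurableSpace.comap (X n) inferInstance) j).trans le_sup_right) le_rfl
  let _ : MeasurableSpace Ω := listingSigma κ X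
  refine MeasurableSet.inter ?_ (measurable_pi_lambda _ (fun k => hX (i k)) hD)
  rw [tupleExists, Set.ofPred_forall]
  exact .iInter fun k => hκ (t := Set.Ioi _) .of_discrete

variable {Ω α : Type*} [MeasurableSpace Ω] [MeasurableSpace α] {P : Measure Ω}
  {Φ : Ω → Set α} {κ : Ω → ℕ∞} {X : ℕ → Ω → α} {C : Ω → α → α → Prop}

lemma IsListing.listingSigma_le (hL : IsListing P Φ κ X) :
    listingSigma κ X ≤ ‹MeasurableSpace Ω› :=
  sup_le hL.measurable_card.comap_le (iSup_le fun n => (hL.measurable_point n).comap_le)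

/-- The event that the consecutive points of the tuple of indices `i` are in conflict. -/
def pathConflict (C : Ω → α → α → Prop) (κ : Ω → ℕ∞) (X : ℕ → Ω → α) {n : ℕ}
    (i : Fin (n + 1) → ℕ) : Set Ω :=
  ⋂ k : Fin n, conflictEvent C κ X (i k.castSucc) (i k.succ)

/-- The ordered form of the pair of the `k`-th and the `k + 1`-st index of a tuple. -/
def stepPair {n : ℕ} (i : Fin (n + 1) → ℕ) (hi : Function.Injective i) (k : Fin n) :
    {q : ℕ × ℕ // q.1 < q.2} :=
  ⟨(min (i k.castSucc) (i k.succ), max (i k.castSucc) (i k.succ)),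
    min_lt_max.2 (hi.ne k.castSucc_lt_succ.ne)⟩

lemma stepPair_injective {n : ℕ} {i : Fin (n + 1) → ℕ} (hi : Function.Injective i) :
    Function.Injective (stepPair i hi) := by
  intro k l hkl
  simp only [stepPair, Subtype.mk.injEq, Prod.mk.injEq] at hkl
  have h : (i k.castSucc = i l.castSucc ∧ i k.succ = i l.succ) ∨
      (i k.castSucc = i l.succ ∧ i k.succ = i l.castSucc) := by lia
  rcases h with h | h
  · exact Fin.castSucc_injective _ (hi h.1)
  · have h1 := congrArg Fin.val (hi h.1)
    have h2 := congrArg Fin.val (hi h.2)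
    simp only [Fin.val_castSucc, Fin.val_succ] at h1 h2
    lia

lemma IsListing.conflictEvent_comm (hL : IsListing P Φ κ X)
    (hsymm : ∀ᵐ ω ∂P, ∀ x ∈ Φ ω, ∀ y ∈ Φ ω, C ω x y → C ω y x) :
    ∀ᵐ ω ∂P, ∀ a b : ℕ, ω ∈ conflictEvent C κ X a b ↔ ω ∈ conflictEvent C κ X b a := by
  filter_upwards [hsymm, hL.bijOn] with ω hω hbij
  have himp : ∀ a b : ℕ, ω ∈ conflictEvent C κ X a b → ω ∈ conflictEvent C κ X b a :=
    fun a b h => ⟨⟨h.1.2, h.1.1⟩, hω _ (hbij.mapsTo h.1.1) _ (hbij.mapsTo h.1.2) h.2⟩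
  exact fun a b => ⟨himp a b, himp b a⟩

/-- Given the points, the conflicts along a path without repeated vertices are independent, since
the path uses each unordered pair at most once. -/
lemma condExp_pathConflict {p : α → α → ℝ} (hL : IsListing P Φ κ X)
    (hsymm : ∀ᵐ ω ∂P, ∀ x ∈ Φ ω, ∀ y ∈ Φ ω, C ω x y → C ω y x)
    (hind : ∀ S : Finset {q : ℕ × ℕ // q.1 < q.2},
      P⟦⋂ q ∈ S, conflictEvent C κ X q.1.1 q.1.2 | listingSigma κ X⟧ =ᵐ[P]
        ∏ q ∈ S, P⟦conflictEvent C κ X q.1.1 q.1.2 | listingSigma κ X⟧)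
    (hber : ∀ i j, i ≠ j → P⟦conflictEvent C κ X i j | listingSigma κ X⟧ =ᵐ[P]
      (pairExists κ i j).indicator (fun ω => p (X i ω) (X j ω)))
    {n : ℕ} {i : Fin (n + 1) → ℕ} (hi : Function.Injective i) :
    P⟦pathConflict C κ X i | listingSigma κ X⟧ =ᵐ[P] fun ω => ∏ k : Fin n,
      (pairExists κ (i k.castSucc) (i k.succ)).indicator
        (fun ω => p (X (i k.castSucc) ω) (X (i k.succ) ω)) ω := by
  classical
  have hcomm := hL.conflictEvent_comm hsymm
  have hstep : ∀ᵐ ω ∂P, ∀ k : Fin n,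
      ω ∈ conflictEvent C κ X (stepPair i hi k).1.1 (stepPair i hi k).1.2 ↔
        ω ∈ conflictEvent C κ X (i k.castSucc) (i k.succ) := by
    filter_upwards [hcomm] with ω hω k
    rcases le_total (i k.castSucc) (i k.succ) with hle | hle
    · simp only [stepPair, min_eq_left hle, max_eq_right hle]
    · simp only [stepPair, min_eq_right hle, max_eq_left hle, hω (i k.succ)]
  have hpath : P⟦pathConflict C κ X i | listingSigma κ X⟧ =ᵐ[P]
      P⟦⋂ q ∈ Finset.univ.image (stepPair i hi), conflictEvent C κ X q.1.1 q.1.2 |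
        listingSigma κ X⟧ := by
    refine condExp_congr_ae ?_
    filter_upwards [hstep] with ω hω
    have : ω ∈ pathConflict C κ X i ↔
        ω ∈ ⋂ q ∈ Finset.univ.image (stepPair i hi), conflictEvent C κ X q.1.1 q.1.2 := by
      simp [pathConflict, hω]
    simp only [Set.indicator_apply, this]
  have hone : ∀ᵐ ω ∂P, ∀ k : Fin n,
      (P⟦conflictEvent C κ X (stepPair i hi k).1.1 (stepPair i hi k).1.2 | listingSigma κ X⟧) ω =
        (pairExists κ (i k.castSucc) (i k.succ)).indicator
          (fun ω => p (X (i k.castSucc) ω) (X (i k.succ) ω)) ω := by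
    refine ae_all_iff.2 fun k => EventuallyEq.trans ?_
      (hber (i k.castSucc) (i k.succ) (hi.ne k.castSucc_lt_succ.ne))
    refine condExp_congr_ae ?_
    filter_upwards [hstep] with ω hω
    simp only [Set.indicator_apply, hω k]
  filter_upwards [hpath, hind (Finset.univ.image (stepPair i hi)), hone] with ω h1 h2 h3
  rw [h1, h2, Finset.prod_image fun k _ l _ h => stepPair_injective hi h, Finset.prod_apply]
  exact Finset.prod_congr rfl fun k _ => h3 k

/-- The event that the points listed with indices `i 0, …, i n` form a chain: they exist, each is
in conflict with the next one and has a larger timer, and the starting point lies in `A`. -/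
def chainEvent (C : Ω → α → α → Prop) (κ : Ω → ℕ∞) (X : ℕ → Ω → α) (τ : α → ℝ≥0) (A : Set α)
    {n : ℕ} (i : Fin (n + 1) → ℕ) : Set Ω :=
  {ω | (∀ k, (i k : ℕ∞) < κ ω) ∧ X (i 0) ω ∈ A ∧
    ∀ k : Fin n, τ (X (i k.succ) ω) < τ (X (i k.castSucc) ω) ∧
      C ω (X (i k.castSucc) ω) (X (i k.succ) ω)}

/-- The weight of a step of a chain: the conflict probability if the timer decreases, and zero
otherwise. -/
noncomputable def stepWeight (p : α → α → ℝ) (τ : α → ℝ≥0) (x y : α) : ℝ≥0∞ :=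
  if τ y < τ x then ENNReal.ofReal (p x y) else 0

lemma measurable_stepWeight {p : α → α → ℝ} (hp : Measurable (Function.uncurry p)) {τ : α → ℝ≥0}
    (hτ : Measurable τ) : Measurable (Function.uncurry (stepWeight p τ)) := by
  refine Measurable.ite ?_ hp.ennreal_ofReal measurable_const
  exact measurableSet_lt (hτ.comp measurable_snd) (hτ.comp measurable_fst)

lemma measurableSet_decreasing {τ : α → ℝ≥0} (hτ : Measurable τ) (n : ℕ) :
    MeasurableSet {z : Fin (n + 1) → α | ∀ k : Fin n, τ (z k.succ) < τ (z k.castSucc)} := by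
  rw [Set.ofPred_forall]
  exact .iInter fun k => measurableSet_lt (hτ.comp (measurable_pi_apply _))
    (hτ.comp (measurable_pi_apply _))

lemma measure_chainEvent_le [IsProbabilityMeasure P] {p : α → α → ℝ} (hp : ∀ x y, 0 ≤ p x y)
    (hL : IsListing P Φ κ X)
    (hsymm : ∀ᵐ ω ∂P, ∀ x ∈ Φ ω, ∀ y ∈ Φ ω, C ω x y → C ω y x)
    (hmeas : ∀ i j, i ≠ j → MeasurableSet (conflictEvent C κ X i j))
    (hind : ∀ S : Finset {q : ℕ × ℕ // q.1 < q.2},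
      P⟦⋂ q ∈ S, conflictEvent C κ X q.1.1 q.1.2 | listingSigma κ X⟧ =ᵐ[P]
        ∏ q ∈ S, P⟦conflictEvent C κ X q.1.1 q.1.2 | listingSigma κ X⟧)
    (hber : ∀ i j, i ≠ j → P⟦conflictEvent C κ X i j | listingSigma κ X⟧ =ᵐ[P]
      (pairExists κ i j).indicator (fun ω => p (X i ω) (X j ω)))
    {τ : α → ℝ≥0} (hτ : Measurable τ) {A : Set α} (hA : MeasurableSet A)
    {n : ℕ} (i : Fin (n + 1) → ℕ) :
    P (chainEvent C κ X τ A i) ≤ ∫⁻ ω in tupleExists κ i,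
      A.indicator 1 (X (i 0) ω) * chainWeight (stepWeight p τ) (fun k => X (i k) ω) ∂P := by
  by_cases hi : Function.Injective i
  swap
  · -- The timers decrease strictly along a chain, which therefore visits no point twice.
    have hempty : chainEvent C κ X τ A i = ∅ := by
      refine Set.eq_empty_of_forall_notMem fun ω hω => hi ?_
      have hanti : StrictAnti fun k => τ (X (i k) ω) :=
        Fin.strictAnti_iff_succ_lt.2 fun k => (hω.2.2 k).1
      intro k l hkl
      exact hanti.injective (by simp only [hkl])
    simp [hempty]
  let D : Set (Fin (n + 1) → α) := {z | z 0 ∈ A} ∩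
    {z | ∀ k : Fin n, τ (z k.succ) < τ (z k.castSucc)}
  have hD : MeasurableSet D :=
    (measurable_pi_apply 0 hA).inter (measurableSet_decreasing hτ n)
  let G := tupleExists κ i ∩ (fun ω k => X (i k) ω) ⁻¹' D
  have hG : MeasurableSet[listingSigma κ X] G := measurableSet_listingSigma_tuple i hD
  have hGm : MeasurableSet G := hL.listingSigma_le _ hG
  have hE : MeasurableSet (pathConflict C κ X i) :=
    .iInter fun k => hmeas _ _ (hi.ne k.castSucc_lt_succ.ne)
  have hsub : chainEvent C κ X τ A i ⊆ pathConflict C κ X i ∩ G := fun ω hω =>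
    ⟨Set.mem_iInter.2 fun k => ⟨⟨hω.1 _, hω.1 _⟩, (hω.2.2 k).2⟩,
      hω.1, hω.2.1, fun k => (hω.2.2 k).1⟩
  have hcond := condExp_pathConflict hL hsymm hind hber hi
  set q : Ω → ℝ := fun ω => ∏ k : Fin n, (pairExists κ (i k.castSucc) (i k.succ)).indicator
    (fun ω => p (X (i k.castSucc) ω) (X (i k.succ) ω)) ω with hq
  have hind_nonneg : ∀ ω (k : Fin n), 0 ≤ (pairExists κ (i k.castSucc) (i k.succ)).indicator
      (fun ω => p (X (i k.castSucc) ω) (X (i k.succ) ω)) ω :=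
    fun ω k => Set.indicator_nonneg (fun _ _ => hp _ _) ω
  have hint : Integrable q P := integrable_condExp.congr hcond
  have hreal : P.real (pathConflict C κ X i ∩ G) = ∫ ω in G, q ω ∂P := by
    rw [← setIntegral_congr_ae hGm (hcond.mono fun ω h _ => h),
      setIntegral_condExp hL.listingSigma_le ((integrable_const (1 : ℝ)).indicator hE) hG,
      setIntegral_indicator hE, setIntegral_const, Set.inter_comm]
    simp
  calc P (chainEvent C κ X τ A i) ≤ P (pathConflict C κ X i ∩ G) := measure_mono hsub
    _ = ∫⁻ ω in G, ENNReal.ofReal (q ω) ∂P := by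
        rw [← ofReal_measureReal, hreal, ofReal_integral_eq_lintegral_ofReal hint.integrableOn
          (ae_of_all _ fun ω => Finset.prod_nonneg fun k _ => hind_nonneg ω k)]
    _ ≤ ∫⁻ ω in G, A.indicator 1 (X (i 0) ω) *
          chainWeight (stepWeight p τ) (fun k => X (i k) ω) ∂P := by
        refine setLIntegral_mono' hGm fun ω hω => ?_
        rw [Set.indicator_of_mem (show X (i 0) ω ∈ A from hω.2.1), Pi.one_apply, one_mul, hq,
          ENNReal.ofReal_prod_of_nonneg fun k _ => hind_nonneg ω k]
        refine Finset.prod_le_prod' fun k _ => ?_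
        rw [stepWeight, if_pos (hω.2.2 k)]
        exact ENNReal.ofReal_le_ofReal (Set.indicator_le_self' (fun _ _ => hp _ _) ω)
    _ ≤ _ := lintegral_mono_set Set.inter_subset_left

/-- The expected number of chains of `n` steps that start in `A` is at most the integral of the
weight of the chains. -/
lemma tsum_measure_chainEvent_le [IsProbabilityMeasure P] {μ : Measure α} [SigmaFinite μ]
    (hΦ : IsPoissonProcess P μ Φ) {p : α → α → ℝ} (hp : ∀ x y, 0 ≤ p x y)
    (hpm : Measurable (Function.uncurry p)) (hL : IsListing P Φ κ X)
    (hsymm : ∀ᵐ ω ∂P, ∀ x ∈ Φ ω, ∀ y ∈ Φ ω, C ω x y → C ω y x)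
    (hmeas : ∀ i j, i ≠ j → MeasurableSet (conflictEvent C κ X i j))
    (hind : ∀ S : Finset {q : ℕ × ℕ // q.1 < q.2},
      P⟦⋂ q ∈ S, conflictEvent C κ X q.1.1 q.1.2 | listingSigma κ X⟧ =ᵐ[P]
        ∏ q ∈ S, P⟦conflictEvent C κ X q.1.1 q.1.2 | listingSigma κ X⟧)
    (hber : ∀ i j, i ≠ j → P⟦conflictEvent C κ X i j | listingSigma κ X⟧ =ᵐ[P]
      (pairExists κ i j).indicator (fun ω => p (X i ω) (X j ω)))
    {τ : α → ℝ≥0} (hτ : Measurable τ) {A : Set α} (hA : MeasurableSet A) (n : ℕ) :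
    ∑' i : Fin (n + 1) → ℕ, P (chainEvent C κ X τ A i) ≤
      ∫⁻ z : Fin (n + 1) → α, A.indicator 1 (z 0) * chainWeight (stepWeight p τ) z
        ∂(Measure.pi fun _ => μ) := by
  set F : (Fin (n + 1) → α) → ℝ≥0∞ :=
    fun z => A.indicator 1 (z 0) * chainWeight (stepWeight p τ) z with hF
  have hFm : Measurable F := ((measurable_one.indicator hA).comp (measurable_pi_apply 0)).mul
    (measurable_chainWeight (measurable_stepWeight hpm hτ) n)
  set D : Set (Fin (n + 1) → α) := {z | ∀ k : Fin n, τ (z k.succ) < τ (z k.castSucc)} with hD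
  have hDm : MeasurableSet D := measurableSet_decreasing hτ n
  have hFD : D.indicator F = F := by
    refine Set.indicator_eq_self.2 fun z hz k => ?_
    by_contra hk
    refine hz (mul_eq_zero_of_right _ (Finset.prod_eq_zero (Finset.mem_univ k) ?_))
    rw [stepWeight, if_neg hk]
  have hDinj : D ⊆ {z | Function.Injective fun k => τ (z k)} := fun z hz =>
    StrictAnti.injective (Fin.strictAnti_iff_succ_lt.2 hz)
  calc ∑' i : Fin (n + 1) → ℕ, P (chainEvent C κ X τ A i)
      ≤ ∑' i : Fin (n + 1) → ℕ, ∫⁻ ω in tupleExists κ i, F (fun k => X (i k) ω) ∂P :=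
        ENNReal.tsum_le_tsum fun i =>
          measure_chainEvent_le hp hL hsymm hmeas hind hber hτ hA i
    _ = ∫⁻ z, F z ∂(tupleMeasure P κ X (n + 1)) := by
        rw [tupleMeasure, lintegral_sum_measure]
        refine tsum_congr fun i => ?_
        rw [lintegral_map hFm (measurable_pi_lambda _ fun k => hL.measurable_point _)]
    _ = ∫⁻ z in D, F z ∂(tupleMeasure P κ X (n + 1)) := by
        rw [← lintegral_indicator hDm, hFD]
    _ = ∫⁻ z in D, F z ∂(Measure.pi fun _ => μ) := by
        rw [Measure.restrict_congr_mono hDinj (hΦ.tupleMeasure_restrict_injective hL hτ (n + 1))]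
    _ ≤ _ := setLIntegral_le_lintegral _ _

end Conditioning

/-! ### Finite history -/

section History

variable {d : ℕ}

/-- The points from which a directed path leads to `x` are the ends of the chains that start
at `x`. -/
lemma exists_chain_of_reflTransGen {φ : Set (Point d)} {c : Point d → Point d → Prop}
    (hc : ∀ x ∈ φ, ∀ y ∈ φ, c x y → c y x) {κ : ℕ∞} {X : ℕ → Point d}
    (hX : Set.SurjOn X {n : ℕ | (n : ℕ∞) < κ} φ) {x y : Point d}
    (h : Relation.ReflTransGen (IsEdge φ c) y x) (hx : x ∈ φ) :
    ∃ (n : ℕ) (i : Fin (n + 1) → ℕ), (∀ k, (i k : ℕ∞) < κ) ∧ X (i 0) = x ∧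
      X (i (Fin.last n)) = y ∧
      ∀ k : Fin n, (X (i k.succ)).2 < (X (i k.castSucc)).2 ∧
        c (X (i k.castSucc)) (X (i k.succ)) := by
  induction h with
  | refl =>
    obtain ⟨j, hj, hjx⟩ := hX hx
    exact ⟨0, fun _ => j, fun _ => hj, hjx, hjx, fun k => k.elim0⟩
  | @tail b x _ hbx ih =>
    obtain ⟨n, i, hi, h0, hlast, hstep⟩ := ih hbx.1
    obtain ⟨j, hj, hjx⟩ := hX hx
    refine ⟨n + 1, Fin.cons j i, Fin.cases hj hi, hjx, ?_, Fin.cases ?_ fun k => ?_⟩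
    · rw [← Fin.succ_last, Fin.cons_succ, hlast]
    · simp only [Fin.castSucc_zero, Fin.cons_zero, Fin.cons_succ, hjx, h0]
      exact ⟨hbx.2.2.2, hc b hbx.1 x hx hbx.2.2.1⟩
    · simpa only [← Fin.succ_castSucc, Fin.cons_succ] using hstep k

variable {Ω : Type*} [MeasurableSpace Ω] {P : Measure Ω} [IsProbabilityMeasure P]
  {Λ : Measure (EuclideanSpace ℝ (Fin d))}
  {h : EuclideanSpace ℝ (Fin d) → EuclideanSpace ℝ (Fin d) → ℝ}
  {Φ : Ω → Set (Point d)} {C : Ω → Point d → Point d → Prop}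

lemma lintegral_stepWeight_mul_exp_le [SigmaFinite Λ] (h_meas : Measurable (Function.uncurry h))
    {a : ℝ} (ha : 0 < a) (x : Point d) :
    ∫⁻ y, stepWeight (fun x y : Point d => h x.1 y.1) Prod.snd x y *
        ENNReal.ofReal (Real.exp (a * y.2)) ∂(Λ.prod timeMeasure) ≤
      (⨆ x, ∫⁻ y, ENNReal.ofReal (h x y) ∂Λ) * ENNReal.ofReal a⁻¹ *
        ENNReal.ofReal (Real.exp (a * x.2)) := by
  have hsplit : ∀ y : Point d, stepWeight (fun x y : Point d => h x.1 y.1) Prod.snd x y *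
      ENNReal.ofReal (Real.exp (a * y.2)) = ENNReal.ofReal (h x.1 y.1) *
        (if y.2 < x.2 then ENNReal.ofReal (Real.exp (a * y.2)) else 0) := by
    intro y
    unfold stepWeight
    split_ifs <;> simp
  simp_rw [hsplit]
  rw [lintegral_prod_mul (f := fun y => ENNReal.ofReal (h x.1 y))
    (g := fun s : ℝ≥0 => if s < x.2 then ENNReal.ofReal (Real.exp (a * s)) else 0)
    h_meas.of_uncurry_left.ennreal_ofReal.aemeasurable
    (Measurable.ite measurableSet_Iio (by fun_prop) measurable_const).aemeasurable, mul_assoc]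
  exact mul_le_mul' (le_iSup (fun x => ∫⁻ y, ENNReal.ofReal (h x y) ∂Λ) x.1)
    (lintegral_exp_timeMeasure_le ha x.2)

lemma IsPRRCR.ae_finiteHistory [SigmaFinite Λ] (h_meas : Measurable (Function.uncurry h))
    (h_nonneg : ∀ x y, 0 ≤ h x y) (h_sup : (⨆ x, ∫⁻ y, ENNReal.ofReal (h x y) ∂Λ) < ∞)
    (hΦ : IsPRRCR P Λ h Φ C) : ∀ᵐ ω ∂P, FiniteHistory (Φ ω) (C ω) := by
  obtain ⟨κ, X, hL, hCm, hind, hber⟩ := hΦ.bernoulli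
  set p : Point d → Point d → ℝ := fun x y => h x.1 y.1 with hp
  have hpm : Measurable (Function.uncurry p) :=
    h_meas.comp ((measurable_fst.comp measurable_fst).prodMk (measurable_fst.comp measurable_snd))
  set M : ℝ≥0 := (⨆ x, ∫⁻ y, ENNReal.ofReal (h x y) ∂Λ).toNNReal with hM
  have hMsup : (⨆ x, ∫⁻ y, ENNReal.ofReal (h x y) ∂Λ) = M := (ENNReal.coe_toNNReal h_sup.ne).symm
  -- With this rate `a`, a step multiplies the weight `exp (a * t)` by at most `M / a ≤ 1 / 2`.
  let a : ℝ := 2 * M + 1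
  have ha : 0 < a := by positivity
  let w : Point d → ℝ≥0∞ := fun x => ENNReal.ofReal (Real.exp (a * x.2))
  have hw : ∀ x, 1 ≤ w x := fun x =>
    ENNReal.one_le_ofReal.2 (Real.one_le_exp (mul_nonneg ha.le x.2.2))
  have hr : ∀ x, ∫⁻ y, stepWeight p Prod.snd x y * w y ∂(Λ.prod timeMeasure) ≤ 2⁻¹ * w x := by
    intro x
    refine (lintegral_stepWeight_mul_exp_le h_meas ha x).trans ?_
    gcongr
    rw [hMsup, ← ENNReal.ofReal_coe_nnreal, ← ENNReal.ofReal_mul (NNReal.coe_nonneg M),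
      ENNReal.ofReal_le_iff_le_toReal (by simp)]
    simp only [ENNReal.toReal_inv, ENNReal.toReal_ofNat]
    rw [← div_eq_mul_inv, div_le_iff₀ ha]
    linarith
  let A : ℕ → Set (Point d) := fun m => spanningSets Λ m ×ˢ Set.Ico 0 (m : ℝ≥0)
  have hA : ∀ m, MeasurableSet (A m) := fun m =>
    (measurableSet_spanningSets Λ m).prod measurableSet_Ico
  have hAw : ∀ m, ∫⁻ x in A m, w x ∂(Λ.prod timeMeasure) < ∞ := by
    intro m
    have hμA : (Λ.prod timeMeasure) (A m) < ∞ := by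
      rw [Measure.prod_prod, timeMeasure_Ico]
      exact ENNReal.mul_lt_top (measure_spanningSets_lt_top Λ m) (by simp)
    refine setLIntegral_lt_top_of_le_nnreal hμA.ne ⟨(Real.exp (a * m)).toNNReal, fun x hx => ?_⟩
    refine ENNReal.ofReal_le_ofReal (Real.exp_le_exp.2 (mul_le_mul_of_nonneg_left ?_ ha.le))
    exact_mod_cast hx.2.2.le
  have hfin : ∀ᵐ ω ∂P, ∀ m, {q : Σ n : ℕ, Fin (n + 1) → ℕ |
      ω ∈ chainEvent C κ X Prod.snd (A m) q.2}.Finite := by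
    refine ae_all_iff.2 fun m => ae_finite_setOfPred_mem (ne_of_lt ?_)
    rw [ENNReal.tsum_sigma']
    calc _ ≤ ∑' n : ℕ, (2⁻¹ : ℝ≥0∞) ^ n * ∫⁻ x in A m, w x ∂(Λ.prod timeMeasure) :=
          ENNReal.tsum_le_tsum fun n =>
            (tsum_measure_chainEvent_le hΦ.poisson (fun x y => h_nonneg _ _) hpm hL hΦ.symm hCm
              hind hber measurable_snd (hA m) n).trans
            (lintegral_chainWeight_le (measurable_stepWeight hpm measurable_snd) hw hr
              (by simp) (hA m) n)
      _ < ∞ := by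
          rw [ENNReal.tsum_mul_right, ENNReal.tsum_geometric]
          exact ENNReal.mul_lt_top (by simp) (hAw m)
  filter_upwards [hfin, hΦ.symm, hL.bijOn] with ω hω hsymm hbij x hx
  obtain ⟨m₁, hm₁⟩ := Set.mem_iUnion.1
    (show x.1 ∈ ⋃ m, spanningSets Λ m by simp [iUnion_spanningSets])
  obtain ⟨m₂, hm₂⟩ := exists_nat_gt x.2
  have hxA : x ∈ A (max m₁ m₂) :=
    ⟨monotone_spanningSets Λ (le_max_left _ _) hm₁, zero_le,
      hm₂.trans_le (by exact_mod_cast le_max_right m₁ m₂)⟩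
  refine ((hω (max m₁ m₂)).image fun q => X (q.2 (Fin.last q.1)) ω).subset fun y hy => ?_
  obtain ⟨n, i, hi, h0, hlast, hstep⟩ :=
    exists_chain_of_reflTransGen hsymm hbij.surjOn hy.2.to_reflTransGen hx
  exact ⟨⟨n, i⟩, ⟨hi, h0 ▸ hxA, hstep⟩, hlast⟩

end History

end MaternRain

open MaternRain in
theorem propositionP {d : ℕ} {Ω : Type*} [MeasurableSpace Ω] (P : Measure Ω)
    [IsProbabilityMeasure P]
    (Λ : Measure (EuclideanSpace ℝ (Fin d))) [IsLocallyFiniteMeasure Λ]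
    (h : EuclideanSpace ℝ (Fin d) → EuclideanSpace ℝ (Fin d) → ℝ)
    (h_meas : Measurable (Function.uncurry h))
    (h_range : ∀ x y, h x y ∈ Set.Icc (0 : ℝ) 1)
    (h_sup : (⨆ x, ∫⁻ y, ENNReal.ofReal (h x y) ∂Λ) < ∞)
    (Φ : Ω → Set (Point d)) (C : Ω → Point d → Point d → Prop)
    (hΦ : IsPRRCR P Λ h Φ C) :
    ∀ᵐ ω ∂P,
      FiniteHistory (Φ ω) (C ω) ∧
      (∃! e : Φ ω → ℤ, IsInftyIndicator (Φ ω) (C ω) e) ∧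
      (∀ e : Φ ω → ℤ, IsInftyIndicator (Φ ω) (C ω) e → ∀ x : Φ ω,
        Tendsto (fun k : ℕ => (matern (Φ ω) (C ω) k).indicator (fun _ => (1 : ℤ)) (x : Point d))
          atTop (𝓝 (e x))) ∧
      (⋃ k : ℕ, matern (Φ ω) (C ω) (2 * k + 1)) = maternInfty (Φ ω) (C ω) ∧
      (⋂ k : ℕ, matern (Φ ω) (C ω) (2 * k)) = maternInfty (Φ ω) (C ω) := by
  filter_upwards [hΦ.ae_finiteHistory h_meas (fun x y => (h_range x y).1) h_sup,
    hΦ.poisson.ae_timer_injOn, hΦ.irrefl, hΦ.symm] with ω hfin hinj hirr hsymm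
  have hc : IsConflictRelation (Φ ω) (C ω) :=
    ⟨hsymm, fun x hx y hy hxy ht => hirr x hx (by rwa [← hinj hx hy ht] at hxy)⟩
  exact ⟨hfin, hfin.existsUnique_isInftyIndicator, hfin.matern_limit hc⟩
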